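/- Fix $B>0$ and $\gamma\in(0,1)$. A real random variable $\xi$ is called subgaussian with moment $B$ if $\mathbb P(|\xi|>t)\le 2\exp(-t^2/B^2)$ for all $t>0$. For $v\in\mathbb C^n$ let $$[v]=\begin{pmatrix}\operatorname{Re}(v)^T&-\operatorname{Im}(v)^T\\ \operatorname{Im}(v)^T&\operatorname{Re}(v)^T\end{pmatrix}\in\mathbb R^{2\times 2n},$$ and for $\alpha>0$ let the essential least common denominator of $v$ be $$LCD_{\alpha,\gamma}(v)=\inf\big\{\|\theta\|_2:\ \theta\in\mathbb R^2,\ \operatorname{dist}([v]^T\theta,\mathbb Z^{2n})<\min(\gamma\|\theta\|_2,\alpha)\big\},$$ where $\operatorname{dist}$ is the Euclidean distance. Theorem (small ball probability via LCD). There exist a constant $c>0$ depending only on $B$ and a constant $C>0$ depending only on $B$ and $\gamma$ such that the following holds. Let $n\ge1$, let $\boldsymbol\xi=(\xi_1,\dots,\xi_{2n})$ be a random vector whose entries $\xi_j$ are iid real random variables with mean $0$, variance $1$, subgaussian with moment $B$, and let $v\in\mathbb C^n$ with $\|v\|_2=1$. Then for every $\alpha>0$ and every $$\varepsilon\ge\frac{4}{LCD_{\alpha,\gamma}(v)}$$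 we have $$\sup_{w\in\mathbb R^2}\mathbb P\big(\|[v]\boldsymbol\xi-w\|_2\le\varepsilon\big)\le C\varepsilon^2+C\exp(-c\alpha^2).$$ -/

import Mathlib

open MeasureTheory ProbabilityTheory
open scoped Matrix

/-- The real `2 × 2n` matrix `[v] = (Re v^T, -Im v^T ; Im v^T, Re v^T)` attached to `v ∈ ℂⁿ`.
The `2n` columns are indexed by `Fin n ⊕ Fin n` (first block, second block). -/
noncomputable def realMatrix {n : ℕ} (v : EuclideanSpace ℂ (Fin n)) :
    Matrix (Fin 2) (Fin n ⊕ Fin n) ℝ :=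
  Matrix.of ![Sum.elim (fun j => (v j).re) (fun j => -(v j).im),
    Sum.elim (fun j => (v j).im) (fun j => (v j).re)]

/-- The integer lattice in the Euclidean space `ℝ^ι`. -/
def integerLattice (ι : Type*) : Set (EuclideanSpace ℝ ι) :=
  {x | ∀ i, ∃ k : ℤ, x i = (k : ℝ)}

/-- The essential least common denominator
`inf {‖θ‖ : θ ∈ ℝ², dist([v]^T θ, ℤ^{2n}) < min(γ ‖θ‖, α)}` of `v ∈ ℂⁿ`;
norms and distances are Euclidean. For `α, γ > 0` the set is non-empty, because multiples of
`[v]^T e₁` return arbitrarily close to the lattice. -/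
noncomputable def complexLCD {n : ℕ} (α γ : ℝ) (v : EuclideanSpace ℂ (Fin n)) : ℝ :=
  sInf {r : ℝ | ∃ θ : EuclideanSpace ℝ (Fin 2), r = ‖θ‖ ∧
    Metric.infDist (WithLp.toLp 2 ((realMatrix v)ᵀ *ᵥ θ.ofLp)) (integerLattice (Fin n ⊕ Fin n))
      < min (γ * ‖θ‖) α}

/-- The subgaussian tail bound `P(|X| > t) ≤ 2 exp(-t²/B²)` for all `t > 0`, with `B > 0`;
that is, `X` is subgaussian with subgaussian moment at most `B`. -/
def IsSubgaussianWith {Ω : Type*} [MeasurableSpace Ω] (P : Measure Ω) (X : Ω → ℝ) (B : ℝ) :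
    Prop :=
  0 < B ∧ ∀ t : ℝ, 0 < t → P.real {ω | t < |X ω|} ≤ 2 * Real.exp (-t ^ 2 / B ^ 2)

/-! Esseen's method reduces the small ball probability to a bound on the characteristic function of
`[v]ξ` on a ball of radius of order `1/ε`. By independence this function is a product of values of
the common characteristic function `φ` at the coordinates of `[v]ᵀu`. Symmetrisation, with `X, X'`
independent copies of an entry, gives `|φ(t)|² = E cos(t(X - X'))`. Since `1 - cos(2πy) ≥ 8 dist(y,
ℤ)²`, the product is at most `exp(-4 E dist(z[v]ᵀu, lattice)²)`, where `z = (X - X')/(2π)`.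

The moment assumptions give `1 ≤ |X - X'| ≤ K` with probability at least `p`, where `K` and `p`
depend only on `B`. On this event `zu` is too short to violate the LCD condition, so the distance is
at least `min(γ‖u‖/(2π), α)`. The product is then at most a Gaussian in `u` plus `exp(-4pα²)`. In
dimension two the Gaussian contributes a multiple of `ε²`, and the constant survives as the second
error term. Hence `c = 4p` does not involve `γ`, which enters only through the Gaussian. -/

/-! ### Esseen's inequality -/

/-- Esseen-type inequality: a Gaussian-plus-constant bound on the characteristic function
in a ball controls the small ball probabilities. -/
theorem measureReal_closedBall_le_of_norm_charFun_le {E : Type*} [NormedAddCommGroup E]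
    [InnerProductSpace ℝ E] [FiniteDimensional ℝ E] [MeasurableSpace E] [BorelSpace E]
    (ν : Measure E) [IsProbabilityMeasure ν] {ρ ε a b : ℝ} (hρ : 0 ≤ ρ)
    (ha : 0 < a) (hρε : ρ * ε ≤ 1)
    (hφ : ∀ u, ‖u‖ ≤ 2 * ρ → ‖charFun ν u‖ ≤ Real.exp (-a * ‖u‖ ^ 2) + b) (w : E) :
    ν.real (Metric.closedBall w ε) * (volume.real (Metric.closedBall (0 : E) ρ) * Real.cos 1) ^ 2
      ≤ volume.real (Metric.closedBall (0 : E) ρ) *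
        ((Real.pi / a) ^ (Module.finrank ℝ E / 2 : ℝ)
          + b * volume.real (Metric.closedBall (0 : E) ρ)) := by
  set A := Metric.closedBall (0 : E) ρ with hA
  set m : Measure E := volume.restrict A with hm
  have hAm : MeasurableSet A := Metric.isClosed_closedBall.measurableSet
  have : IsFiniteMeasure m := by
    rw [hm]; exact isFiniteMeasure_restrict.2 (isCompact_closedBall _ _).measure_lt_top.ne
  have hmV : m.real Set.univ = volume.real A := by simp [hm]
  set F : E → ℂ := fun x => ∫ θ, Complex.exp ((inner ℝ θ (x - w) : ℝ) * Complex.I) ∂m with hF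
  have hexp : ∀ s : ℝ, ‖Complex.exp ((s : ℂ) * Complex.I)‖ = 1 := Complex.norm_exp_ofReal_mul_I
  have hFint : ∀ x, Integrable (fun θ => Complex.exp ((inner ℝ θ (x - w) : ℝ) * Complex.I)) m := by
    intro x
    refine Integrable.of_bound (C := 1) (Continuous.aestronglyMeasurable (by fun_prop)) ?_
    exact Filter.Eventually.of_forall fun θ => (hexp _).le
  -- Writing `‖F‖²` as a double integral makes the `ν`-average an average of `charFun ν` over
  -- differences, which lie in the ball of radius `2ρ`.
  have hGF : ∀ x, ∫ p, Complex.exp ((inner ℝ (p.1 - p.2) (x - w) : ℝ) * Complex.I) ∂(m.prod m)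
      = ((‖F x‖ ^ 2 : ℝ) : ℂ) := by
    intro x
    rw [Complex.ofReal_pow, ← Complex.mul_conj', hF]
    simp only
    rw [← integral_conj, ← integral_prod_mul]
    refine integral_congr_ae (Filter.Eventually.of_forall fun p => ?_)
    simp only [← Complex.exp_conj, ← Complex.exp_add, map_mul, Complex.conj_I, Complex.conj_ofReal,
      inner_sub_left]
    congr 1
    push_cast
    ring
  have hjoint : Integrable (Function.uncurry fun (x : E) (p : E × E) =>
      Complex.exp ((inner ℝ (p.1 - p.2) (x - w) : ℝ) * Complex.I)) (ν.prod (m.prod m)) := by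
    refine Integrable.of_bound (C := 1) (Continuous.aestronglyMeasurable ?_) ?_
    · simp only [Function.uncurry_def]; fun_prop
    · exact Filter.Eventually.of_forall fun q => (hexp _).le
  have hswap : ((∫ x, ‖F x‖ ^ 2 ∂ν : ℝ) : ℂ) = ∫ p, ∫ x,
      Complex.exp ((inner ℝ (p.1 - p.2) (x - w) : ℝ) * Complex.I) ∂ν ∂(m.prod m) := by
    rw [← integral_integral_swap hjoint]
    simp only [hGF]
    exact integral_ofReal.symm
  have hFsq : Integrable (fun x => ‖F x‖ ^ 2) ν := by
    have h := hjoint.integral_prod_left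
    simp only [Function.uncurry_def, hGF] at h
    exact h.re.congr (Filter.Eventually.of_forall fun x => Complex.ofReal_re _)
  -- The centre `w` contributes only a unimodular phase, so the bound is uniform in `w`.
  have hin : ∀ p : E × E, ‖∫ x, Complex.exp ((inner ℝ (p.1 - p.2) (x - w) : ℝ) * Complex.I) ∂ν‖
      = ‖charFun ν (p.1 - p.2)‖ := by
    intro p
    have : ∀ x, Complex.exp ((inner ℝ (p.1 - p.2) (x - w) : ℝ) * Complex.I)
        = Complex.exp ((inner ℝ x (p.1 - p.2) : ℝ) * Complex.I) *
          Complex.exp ((-inner ℝ (p.1 - p.2) w : ℝ) * Complex.I) := by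
      intro x
      rw [← Complex.exp_add, inner_sub_right, real_inner_comm (p.1 - p.2) x]
      congr 1
      push_cast
      ring
    simp_rw [this]
    rw [integral_mul_const, norm_mul, hexp, mul_one, charFun_apply]
  have hgauss : Integrable (fun v : E => Real.exp (-a * ‖v‖ ^ 2)) := by
    have h := (GaussianFourier.integrable_cexp_neg_mul_sq_norm_add (V := E) (b := a)
      (by simpa using ha) 0 0).re
    refine h.congr (Filter.Eventually.of_forall fun v => ?_)
    simp only [zero_mul, add_zero]
    rw [show -(a : ℂ) * (‖v‖ : ℂ) ^ 2 = ((-a * ‖v‖ ^ 2 : ℝ) : ℂ) by push_cast; ring]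
    exact Complex.exp_ofReal_re _
  have hgprod : Integrable (fun p : E × E => Real.exp (-a * ‖p.1 - p.2‖ ^ 2)) (m.prod m) := by
    refine Integrable.of_bound (C := 1) (Continuous.aestronglyMeasurable (by fun_prop)) ?_
    refine Filter.Eventually.of_forall fun q => ?_
    rw [Real.norm_of_nonneg (Real.exp_pos _).le, Real.exp_le_one_iff]
    have := mul_nonneg ha.le (sq_nonneg ‖q.1 - q.2‖)
    linarith
  have hupper : ∫ x, ‖F x‖ ^ 2 ∂ν ≤ volume.real A *
        ((Real.pi / a) ^ (Module.finrank ℝ E / 2 : ℝ) + b * volume.real A) := by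
    have h0 : ∫ x, ‖F x‖ ^ 2 ∂ν ≤ ∫ p : E × E, ‖charFun ν (p.1 - p.2)‖ ∂(m.prod m) := by
      have hn : (0 : ℝ) ≤ ∫ x, ‖F x‖ ^ 2 ∂ν := integral_nonneg fun x => by positivity
      calc ∫ x, ‖F x‖ ^ 2 ∂ν = ‖((∫ x, ‖F x‖ ^ 2 ∂ν : ℝ) : ℂ)‖ := by
            rw [Complex.norm_real, Real.norm_of_nonneg hn]
        _ ≤ _ := by
            rw [hswap]
            refine (norm_integral_le_integral_norm _).trans (le_of_eq ?_)
            simp only [hin]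
    have hmem : ∀ᵐ p ∂(m.prod m), p.1 ∈ A ∧ p.2 ∈ A := by
      rw [hm, Measure.prod_restrict]
      exact ae_restrict_mem (hAm.prod hAm)
    have h1 : ∫ p : E × E, ‖charFun ν (p.1 - p.2)‖ ∂(m.prod m)
        ≤ ∫ p : E × E, (Real.exp (-a * ‖p.1 - p.2‖ ^ 2) + b) ∂(m.prod m) := by
      refine integral_mono_of_nonneg (Filter.Eventually.of_forall fun _ => norm_nonneg _)
        (hgprod.add (integrable_const b)) ?_
      filter_upwards [hmem] with p hp
      refine hφ _ ?_
      have h1 := hp.1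
      have h2 := hp.2
      rw [hA, mem_closedBall_zero_iff] at h1 h2
      linarith [norm_sub_le p.1 p.2]
    -- One variable is integrated over the whole space, so only one factor `volume.real A` appears;
    -- this is the source of the gain over the trivial bound.
    have h2 : ∫ p : E × E, Real.exp (-a * ‖p.1 - p.2‖ ^ 2) ∂(m.prod m)
        ≤ volume.real A * (Real.pi / a) ^ (Module.finrank ℝ E / 2 : ℝ) := by
      rw [integral_prod _ hgprod]
      have hle : ∀ x : E, ∫ y, Real.exp (-a * ‖x - y‖ ^ 2) ∂m
          ≤ (Real.pi / a) ^ (Module.finrank ℝ E / 2 : ℝ) := by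
        intro x
        rw [← GaussianFourier.integral_rexp_neg_mul_sq_norm (V := E) ha,
          ← integral_sub_left_eq_self (fun v : E => Real.exp (-a * ‖v‖ ^ 2)) volume x]
        exact setIntegral_le_integral (hgauss.comp_sub_left x)
          (Filter.Eventually.of_forall fun _ => (Real.exp_pos _).le)
      calc _ ≤ ∫ _ : E, (Real.pi / a) ^ (Module.finrank ℝ E / 2 : ℝ) ∂m :=
            integral_mono hgprod.integral_prod_left (integrable_const _) hle
        _ = _ := by rw [integral_const, hmV, smul_eq_mul]
    have h3 : ∫ p : E × E, (Real.exp (-a * ‖p.1 - p.2‖ ^ 2) + b) ∂(m.prod m)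
        = ∫ p : E × E, Real.exp (-a * ‖p.1 - p.2‖ ^ 2) ∂(m.prod m)
          + b * volume.real A * volume.real A := by
      rw [integral_add hgprod (integrable_const b), integral_const, ← Set.univ_prod_univ,
        measureReal_prod_prod, hmV, smul_eq_mul]
      ring
    rw [h3] at h1
    linarith
  have hcos : 0 < Real.cos 1 := Real.cos_one_pos
  -- On the ball the phase is at most `ρε ≤ 1` in absolute value, so its cosine never falls below
  -- `cos 1`.
  have hlow : ∀ x ∈ Metric.closedBall w ε, (volume.real A * Real.cos 1) ^ 2 ≤ ‖F x‖ ^ 2 := by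
    intro x hx
    have hre : volume.real A * Real.cos 1 ≤ ‖F x‖ := by
      refine le_trans ?_ (Complex.re_le_norm _)
      have : (F x).re = ∫ θ, Real.cos (inner ℝ θ (x - w)) ∂m := by
        have := integral_re (hFint x)
        simp only [RCLike.re_to_complex, Complex.exp_ofReal_mul_I_re] at this
        exact this.symm
      rw [this, ← hmV, ← smul_eq_mul, ← integral_const]
      refine integral_mono_ae (integrable_const _) ?_ ?_
      · have := (hFint x).re
        simpa only [RCLike.re_to_complex, Complex.exp_ofReal_mul_I_re] using this
      · filter_upwards [ae_restrict_mem hAm] with θ hθ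
        rw [hA, mem_closedBall_zero_iff] at hθ
        rw [mem_closedBall_iff_norm] at hx
        have h1 : |inner ℝ θ (x - w)| ≤ 1 := by
          refine (abs_real_inner_le_norm _ _).trans (le_trans ?_ hρε)
          gcongr
        rw [← Real.cos_abs (inner ℝ θ (x - w))]
        exact Real.cos_le_cos_of_nonneg_of_le_pi (abs_nonneg _)
          (by linarith [Real.pi_gt_three]) h1
    have : 0 ≤ volume.real A * Real.cos 1 := by positivity
    gcongr
  refine le_trans ?_ hupper
  have hBm : MeasurableSet (Metric.closedBall w ε) := Metric.isClosed_closedBall.measurableSet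
  calc ν.real (Metric.closedBall w ε) * (volume.real A * Real.cos 1) ^ 2
      = ∫ _ in Metric.closedBall w ε, (volume.real A * Real.cos 1) ^ 2 ∂ν := by
        rw [setIntegral_const, smul_eq_mul]
    _ ≤ ∫ x in Metric.closedBall w ε, ‖F x‖ ^ 2 ∂ν :=
        setIntegral_mono_on (integrable_const _) hFsq.integrableOn hBm hlow
    _ ≤ ∫ x, ‖F x‖ ^ 2 ∂ν :=
        setIntegral_le_integral hFsq (Filter.Eventually.of_forall fun _ => by positivity)

/-! ### Characteristic functions and distance to the integer lattice -/

/-- Periodicity reduces to `|y| ≤ 1/2`, where `cos x ≤ 1 - 2x²/π²` applies with `x = 2πy`. -/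
theorem eight_mul_sub_round_sq_le_one_sub_cos (y : ℝ) :
    8 * (y - round y) ^ 2 ≤ 1 - Real.cos (2 * Real.pi * y) := by
  have hs : |2 * Real.pi * (y - round y)| ≤ Real.pi := by
    rw [abs_mul, abs_of_pos Real.two_pi_pos]
    nlinarith [abs_sub_round y, Real.pi_pos]
  have h := Real.cos_le_one_sub_mul_cos_sq hs
  have hper : Real.cos (2 * Real.pi * (y - round y)) = Real.cos (2 * Real.pi * y) := by
    rw [show 2 * Real.pi * (y - round y) = 2 * Real.pi * y - round y * (2 * Real.pi) by ring,
      Real.cos_sub_int_mul_two_pi]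
  rw [hper] at h
  have : 2 / Real.pi ^ 2 * (2 * Real.pi * (y - round y)) ^ 2 = 8 * (y - round y) ^ 2 := by
    field_simp
    ring
  linarith

theorem eight_mul_infDist_integerLattice_sq_le {ι : Type*} [Fintype ι]
    (y : EuclideanSpace ℝ ι) :
    8 * Metric.infDist y (integerLattice ι) ^ 2 ≤ ∑ i, (1 - Real.cos (2 * Real.pi * y i)) := by
  set k : EuclideanSpace ℝ ι := WithLp.toLp 2 fun i => (round (y i) : ℝ) with hk
  have hle : Metric.infDist y (integerLattice ι) ≤ dist y k :=
    Metric.infDist_le_dist_of_mem fun i => ⟨round (y i), rfl⟩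
  calc 8 * Metric.infDist y (integerLattice ι) ^ 2 ≤ 8 * dist y k ^ 2 := by
        gcongr
        exact Metric.infDist_nonneg
    _ = ∑ i, 8 * (y i - round (y i)) ^ 2 := by
        rw [EuclideanSpace.dist_eq, Real.sq_sqrt (Finset.sum_nonneg fun _ _ => sq_nonneg _),
          Finset.mul_sum]
        simp [hk, Real.dist_eq, sq_abs]
    _ ≤ _ := Finset.sum_le_sum fun i _ => eight_mul_sub_round_sq_le_one_sub_cos (y i)

theorem integrable_one_sub_cos_mul_sub (μ : Measure ℝ) [IsFiniteMeasure μ] (t : ℝ) :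
    Integrable (fun p : ℝ × ℝ => 1 - Real.cos (t * (p.1 - p.2))) (μ.prod μ) := by
  refine (integrable_const 1).sub ?_
  refine Integrable.of_bound (C := 1) (Continuous.aestronglyMeasurable (by fun_prop)) ?_
  exact Filter.Eventually.of_forall fun p => Real.abs_cos_le_one _

theorem norm_charFun_sq_eq_integral_cos (μ : Measure ℝ) [IsFiniteMeasure μ] (t : ℝ) :
    ‖charFun μ t‖ ^ 2 = ∫ p : ℝ × ℝ, Real.cos (t * (p.1 - p.2)) ∂(μ.prod μ) := by
  have hint : Integrable (fun p : ℝ × ℝ => Complex.exp ((t * (p.1 - p.2) : ℝ) * Complex.I))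
      (μ.prod μ) := by
    refine Integrable.of_bound (C := 1) (Continuous.aestronglyMeasurable (by fun_prop)) ?_
    exact Filter.Eventually.of_forall fun p => (Complex.norm_exp_ofReal_mul_I _).le
  have h : ((‖charFun μ t‖ ^ 2 : ℝ) : ℂ)
      = ∫ p : ℝ × ℝ, Complex.exp ((t * (p.1 - p.2) : ℝ) * Complex.I) ∂(μ.prod μ) := by
    rw [Complex.ofReal_pow, ← Complex.mul_conj', charFun_apply_real, ← integral_conj,
      ← integral_prod_mul]
    refine integral_congr_ae (Filter.Eventually.of_forall fun p => ?_)
    simp only [← Complex.exp_conj, ← Complex.exp_add, map_mul, Complex.conj_I, Complex.conj_ofReal]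
    congr 1
    push_cast
    ring
  have h2 := integral_re hint
  simp only [RCLike.re_to_complex, Complex.exp_ofReal_mul_I_re] at h2
  rw [h2, ← h, Complex.ofReal_re]

/-- This is `x ≤ exp(x - 1)` at `x = ‖charFun μ t‖²`; the factor `1/2` comes from the square. -/
theorem norm_charFun_le_exp_neg_integral_one_sub_cos (μ : Measure ℝ) [IsProbabilityMeasure μ]
    (t : ℝ) :
    ‖charFun μ t‖
      ≤ Real.exp (-(1 / 2) * ∫ p : ℝ × ℝ, (1 - Real.cos (t * (p.1 - p.2))) ∂(μ.prod μ)) := by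
  have hcos : Integrable (fun p : ℝ × ℝ => Real.cos (t * (p.1 - p.2))) (μ.prod μ) := by
    refine Integrable.of_bound (C := 1) (Continuous.aestronglyMeasurable (by fun_prop)) ?_
    exact Filter.Eventually.of_forall fun p => Real.abs_cos_le_one _
  rw [integral_sub (integrable_const _) hcos, ← norm_charFun_sq_eq_integral_cos, integral_const,
    probReal_univ, one_smul]
  refine le_of_sq_le_sq ?_ (Real.exp_pos _).le
  rw [← Real.exp_nat_mul]
  have := Real.add_one_le_exp (‖charFun μ t‖ ^ 2 - 1)
  push_cast
  rw [show (2 : ℝ) * (-(1 / 2) * (1 - ‖charFun μ t‖ ^ 2)) = ‖charFun μ t‖ ^ 2 - 1 by ring]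
  linarith

/-- The characteristic function of a linear image of an i.i.d. vector is controlled by the distance
of the dual vector to the integer lattice. -/
theorem prod_norm_charFun_le_exp {ι : Type*} [Fintype ι] (μ : Measure ℝ) [IsProbabilityMeasure μ]
    (y : EuclideanSpace ℝ ι) {s : Set (ℝ × ℝ)} (hs : MeasurableSet s) {d : ℝ} (hd0 : 0 ≤ d)
    (hd : ∀ p ∈ s, d ≤ Metric.infDist (((p.1 - p.2) / (2 * Real.pi)) • y) (integerLattice ι)) :
    ∏ i, ‖charFun μ (y i)‖ ≤ Real.exp (-4 * (μ.prod μ).real s * d ^ 2) := by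
  have hint : ∀ i, Integrable (fun p : ℝ × ℝ => 1 - Real.cos (y i * (p.1 - p.2))) (μ.prod μ) :=
    fun i => integrable_one_sub_cos_mul_sub μ (y i)
  have hsum := integrable_finsetSum Finset.univ fun i _ => hint i
  have key : 8 * (μ.prod μ).real s * d ^ 2
      ≤ ∑ i, ∫ p : ℝ × ℝ, (1 - Real.cos (y i * (p.1 - p.2))) ∂(μ.prod μ) := by
    rw [← integral_finsetSum _ fun i _ => hint i]
    calc 8 * (μ.prod μ).real s * d ^ 2 = ∫ _ in s, 8 * d ^ 2 ∂(μ.prod μ) := by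
          rw [setIntegral_const, smul_eq_mul]; ring
      _ ≤ ∫ p in s, ∑ i, (1 - Real.cos (y i * (p.1 - p.2))) ∂(μ.prod μ) := by
          refine setIntegral_mono_on (integrable_const _) hsum.integrableOn hs fun p hp => ?_
          have h1 := eight_mul_infDist_integerLattice_sq_le (((p.1 - p.2) / (2 * Real.pi)) • y)
          have h2 := pow_le_pow_left₀ hd0 (hd p hp) 2
          refine (by linarith : 8 * d ^ 2 ≤ _).trans (h1.trans (le_of_eq ?_))
          refine Finset.sum_congr rfl fun i _ => ?_
          rw [PiLp.smul_apply, smul_eq_mul]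
          congr 2
          field_simp
      _ ≤ _ := setIntegral_le_integral hsum (Filter.Eventually.of_forall fun p =>
          Finset.sum_nonneg fun i _ => sub_nonneg.2 (Real.cos_le_one _))
  calc ∏ i, ‖charFun μ (y i)‖ ≤ ∏ i, Real.exp
        (-(1 / 2) * ∫ p : ℝ × ℝ, (1 - Real.cos (y i * (p.1 - p.2))) ∂(μ.prod μ)) :=
        Finset.prod_le_prod (fun _ _ => norm_nonneg _) fun i _ =>
          norm_charFun_le_exp_neg_integral_one_sub_cos μ (y i)
    _ ≤ _ := by
        rw [← Real.exp_sum, ← Finset.mul_sum]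
        refine Real.exp_le_exp.2 ?_
        linarith

/-! ### Moments and non-degeneracy of symmetrised entries -/

/-- Subgaussian tails give a fourth moment bound depending only on the subgaussian moment. -/
theorem exists_lintegral_pow_four_le_of_tail {B : ℝ} (hB : 0 < B) :
    ∃ M : ℝ, 0 ≤ M ∧ ∀ (μ : Measure ℝ) [IsProbabilityMeasure μ],
      (∀ t : ℝ, 0 < t → μ.real {x | t < |x|} ≤ 2 * Real.exp (-t ^ 2 / B ^ 2)) →
      ∫⁻ x, ENNReal.ofReal (x ^ 4) ∂μ ≤ ENNReal.ofReal M := by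
  have hint := integrableOn_rpow_mul_exp_neg_mul_sq (b := 1 / B ^ 2) (by positivity)
    (s := 3) (by norm_num)
  -- `8 = 4 · 2`: the exponent in the layer-cake formula times the constant in the tail bound.
  refine ⟨8 * ∫ t in Set.Ioi (0 : ℝ), t ^ (3 : ℝ) * Real.exp (-(1 / B ^ 2) * t ^ 2),
    mul_nonneg (by norm_num) (setIntegral_nonneg measurableSet_Ioi fun t ht => ?_),
    fun μ _ h => ?_⟩
  · have : (0 : ℝ) < t := ht
    positivity
  have h1 := lintegral_rpow_eq_lintegral_meas_lt_mul μ (f := fun x : ℝ => |x|)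
    (Filter.Eventually.of_forall fun x => abs_nonneg x) (by fun_prop) (p := 4) (by norm_num)
  have h2 : ∀ x : ℝ, |x| ^ (4 : ℝ) = x ^ 4 := fun x => by
    rw [show (4 : ℝ) = ((4 : ℕ) : ℝ) by norm_num, Real.rpow_natCast, Even.pow_abs (by decide)]
  simp only [h2] at h1
  rw [h1, show (8 : ℝ) = 4 * 2 by norm_num, mul_assoc, ENNReal.ofReal_mul (by norm_num),
    ← integral_const_mul, ofReal_integral_eq_lintegral_ofReal (hint.const_mul 2)]
  · gcongr 1
    refine setLIntegral_mono_ae' measurableSet_Ioi (Filter.Eventually.of_forall fun t ht => ?_)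
    have ht : (0 : ℝ) < t := ht
    rw [← ofReal_measureReal, ← ENNReal.ofReal_mul measureReal_nonneg]
    refine ENNReal.ofReal_le_ofReal ?_
    rw [show (4 : ℝ) - 1 = 3 by norm_num]
    have := mul_le_mul_of_nonneg_right (h t ht) (by positivity : 0 ≤ t ^ (3 : ℝ))
    rw [show -(1 / B ^ 2) * t ^ 2 = -t ^ 2 / B ^ 2 by ring]
    linarith
  · refine (ae_restrict_iff' measurableSet_Ioi).2 (Filter.Eventually.of_forall fun t ht => ?_)
    have ht : (0 : ℝ) < t := ht
    simp only [Pi.zero_apply]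
    positivity

/-- The difference of two independent copies of a standardized subgaussian variable is bounded
away from zero and infinity with probability bounded below. -/
theorem exists_le_measureReal_abs_sub_mem_Icc {B : ℝ} (hB : 0 < B) :
    ∃ K p : ℝ, 1 ≤ K ∧ 0 < p ∧ ∀ (μ : Measure ℝ) [IsProbabilityMeasure μ],
      (∀ t : ℝ, 0 < t → μ.real {x | t < |x|} ≤ 2 * Real.exp (-t ^ 2 / B ^ 2)) →
      ∫ x, x ∂μ = 0 → variance id μ = 1 →
      p ≤ (μ.prod μ).real {q : ℝ × ℝ | |q.1 - q.2| ∈ Set.Icc 1 K} := by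
  obtain ⟨M, hM0, hM⟩ := exists_lintegral_pow_four_le_of_tail hB
  -- `L` makes the fourth-moment term `16M/L` at most `1/2`. Since `E(X - X')² = 2`, what remains is
  -- `L · P(s) ≥ 1/2`.
  set L : ℝ := 32 * M + 1 with hL
  have hL1 : 1 ≤ L := by linarith
  refine ⟨√L, 1 / (2 * L), Real.one_le_sqrt.2 hL1, by positivity, fun μ _ htail hmean hvar => ?_⟩
  have h4 : Integrable (fun x : ℝ => x ^ 4) μ := by
    refine ⟨Continuous.aestronglyMeasurable (by fun_prop), ?_⟩
    rw [hasFiniteIntegral_iff_ofReal (Filter.Eventually.of_forall fun x => by positivity)]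
    exact (hM μ htail).trans_lt ENNReal.ofReal_lt_top
  have h4M : ∫ x, x ^ 4 ∂μ ≤ M := by
    rw [integral_eq_lintegral_of_nonneg_ae (Filter.Eventually.of_forall fun x => by positivity)
      (Continuous.aestronglyMeasurable (by fun_prop))]
    exact ENNReal.toReal_le_of_le_ofReal hM0 (hM μ htail)
  have h2 : Integrable (fun x : ℝ => x ^ 2) μ := by
    refine (h4.add (integrable_const 1)).mono' (Continuous.aestronglyMeasurable (by fun_prop))
      (Filter.Eventually.of_forall fun x => ?_)
    rw [Real.norm_of_nonneg (sq_nonneg x)]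
    simp only [Pi.add_apply]
    nlinarith [sq_nonneg (x ^ 2 - 1)]
  have hLp : MemLp (id : ℝ → ℝ) 2 μ :=
    (memLp_two_iff_integrable_sq aestronglyMeasurable_id).2 h2
  have h1 : Integrable (fun x : ℝ => x) μ := hLp.integrable one_le_two
  have hsq : ∫ x, x ^ 2 ∂μ = 1 := by
    have := variance_eq_sub hLp
    simp only [Pi.pow_apply, id_eq, hmean, hvar] at this
    linarith
  have hfst : ∀ {f : ℝ → ℝ}, Integrable f μ → Integrable (fun q : ℝ × ℝ => f q.1) (μ.prod μ) :=
    fun hf => hf.comp_fst μ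
  have hsnd : ∀ {f : ℝ → ℝ}, Integrable f μ → Integrable (fun q : ℝ × ℝ => f q.2) (μ.prod μ) :=
    fun hf => hf.comp_snd μ
  have hcross : Integrable (fun q : ℝ × ℝ => q.1 * q.2) (μ.prod μ) := h1.mul_prod h1
  have efst : ∀ f : ℝ → ℝ, ∫ q : ℝ × ℝ, f q.1 ∂(μ.prod μ) = ∫ x, f x ∂μ := fun f => by
    rw [integral_fun_fst, probReal_univ, one_smul]
  have esnd : ∀ f : ℝ → ℝ, ∫ q : ℝ × ℝ, f q.2 ∂(μ.prod μ) = ∫ x, f x ∂μ := fun f => by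
    rw [integral_fun_snd, probReal_univ, one_smul]
  have hdiff : ∫ q : ℝ × ℝ, (q.1 - q.2) ^ 2 ∂(μ.prod μ) = 2 := by
    have : ∀ q : ℝ × ℝ, (q.1 - q.2) ^ 2 = q.1 ^ 2 + q.2 ^ 2 - 2 * (q.1 * q.2) := fun q => by ring
    simp_rw [this]
    have hadd : Integrable (fun q : ℝ × ℝ => q.1 ^ 2 + q.2 ^ 2) (μ.prod μ) :=
      (hfst h2).add (hsnd h2)
    rw [integral_sub hadd (hcross.const_mul 2), integral_add (hfst h2) (hsnd h2), efst fun x => x ^ 2, esnd fun x => x ^ 2,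
      integral_const_mul, integral_prod_mul (fun x : ℝ => x) (fun x : ℝ => x), hmean, hsq]
    norm_num
  set s : Set (ℝ × ℝ) := {q : ℝ × ℝ | |q.1 - q.2| ∈ Set.Icc 1 √L} with hs
  have hsm : MeasurableSet s :=
    measurableSet_Icc.preimage (by fun_prop : Measurable fun q : ℝ × ℝ => |q.1 - q.2|)
  -- The three terms dominate the square for `|q.1 - q.2|` below `1`, in `[1, √L]` and above `√L`
  -- respectively.
  have hpt : ∀ q : ℝ × ℝ, (q.1 - q.2) ^ 2
      ≤ 1 + s.indicator (fun _ => L) q + 8 / L * (q.1 ^ 4 + q.2 ^ 4) := by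
    intro q
    have hL0 : 0 < L := by linarith
    have hquart : (q.1 - q.2) ^ 4 ≤ 8 * (q.1 ^ 4 + q.2 ^ 4) := by
      nlinarith [sq_nonneg (q.1 ^ 2 - q.2 ^ 2), sq_nonneg ((q.1 + q.2) ^ 2),
        sq_nonneg (q.1 - q.2), sq_nonneg (q.1 + q.2), sq_nonneg (q.1 * q.2),
        mul_nonneg (sq_nonneg (q.1 + q.2)) (sq_nonneg (q.1 - q.2))]
    have hnn : 0 ≤ 8 / L * (q.1 ^ 4 + q.2 ^ 4) := by positivity
    have hin : 0 ≤ s.indicator (fun _ => L) q := Set.indicator_nonneg (fun _ _ => hL0.le) q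
    by_cases ha : |q.1 - q.2| < 1
    · have : (q.1 - q.2) ^ 2 ≤ 1 := by
        rw [← sq_abs]; nlinarith [abs_nonneg (q.1 - q.2)]
      linarith
    by_cases hb : |q.1 - q.2| ≤ √L
    · have hq : q ∈ s := ⟨not_lt.1 ha, hb⟩
      rw [Set.indicator_of_mem hq]
      have : (q.1 - q.2) ^ 2 ≤ L := by
        rw [← sq_abs, ← Real.sq_sqrt hL0.le]; gcongr
      linarith
    · have : L ≤ (q.1 - q.2) ^ 2 := by
        rw [← sq_abs, ← Real.sq_sqrt hL0.le]
        exact pow_le_pow_left₀ (Real.sqrt_nonneg _) (not_le.1 hb).le 2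
      have h3 : (q.1 - q.2) ^ 2 ≤ (q.1 - q.2) ^ 4 / L := by
        rw [le_div_iff₀ hL0]; nlinarith [sq_nonneg (q.1 - q.2)]
      have h5 : (q.1 - q.2) ^ 4 / L ≤ 8 / L * (q.1 ^ 4 + q.2 ^ 4) := by
        rw [div_mul_eq_mul_div]; gcongr
      linarith
  have hind : Integrable (s.indicator fun _ => L) (μ.prod μ) :=
    (integrable_const L).indicator hsm
  have hq4 : Integrable (fun q : ℝ × ℝ => q.1 ^ 4 + q.2 ^ 4) (μ.prod μ) := (hfst h4).add (hsnd h4)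
  have hadd : Integrable (fun q : ℝ × ℝ => 1 + s.indicator (fun _ => L) q) (μ.prod μ) :=
    (integrable_const 1).add hind
  have hle : (2 : ℝ) ≤ 1 + (μ.prod μ).real s * L + 8 / L * (M + M) := by
    rw [← hdiff]
    calc ∫ q : ℝ × ℝ, (q.1 - q.2) ^ 2 ∂(μ.prod μ)
        ≤ ∫ q : ℝ × ℝ, (1 + s.indicator (fun _ => L) q + 8 / L * (q.1 ^ 4 + q.2 ^ 4)) ∂(μ.prod μ) :=
          integral_mono_of_nonneg (Filter.Eventually.of_forall fun q => sq_nonneg _)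
            (hadd.add (hq4.const_mul _))
            (Filter.Eventually.of_forall hpt)
      _ = 1 + (μ.prod μ).real s * L + 8 / L * (∫ x, x ^ 4 ∂μ + ∫ x, x ^ 4 ∂μ) := by
          rw [integral_add hadd (hq4.const_mul _),
            integral_add (integrable_const 1) hind, integral_const, probReal_univ, one_smul,
            integral_indicator hsm, setIntegral_const, smul_eq_mul, integral_const_mul,
            integral_add (hfst h4) (hsnd h4), efst fun x => x ^ 4, esnd fun x => x ^ 4]
      _ ≤ _ := by gcongr
  have hML : 8 / L * (M + M) ≤ 1 / 2 := by
    rw [div_mul_eq_mul_div, div_le_iff₀ (by linarith)]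
    linarith
  rw [div_le_iff₀ (by linarith)]
  linarith

/-! ### Geometry of `[v]` and the LCD -/

/-- With `θ` read as a complex number, the `j`-th pair of coordinates of `[v]ᵀθ` is `conj(v j) · θ`.
-/
theorem norm_realMatrix_transpose_mulVec {n : ℕ} (v : EuclideanSpace ℂ (Fin n))
    (θ : EuclideanSpace ℝ (Fin 2)) :
    ‖WithLp.toLp 2 ((realMatrix v)ᵀ *ᵥ θ.ofLp)‖ = ‖v‖ * ‖θ‖ := by
  refine (sq_eq_sq₀ (norm_nonneg _) (by positivity)).1 ?_
  rw [mul_pow, EuclideanSpace.norm_sq_eq, EuclideanSpace.norm_sq_eq, EuclideanSpace.norm_sq_eq,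
    Fintype.sum_sum_type, ← Finset.sum_add_distrib, Finset.sum_mul]
  refine Finset.sum_congr rfl fun j _ => ?_
  simp only [realMatrix, Matrix.mulVec, dotProduct, Fin.sum_univ_two, Matrix.transpose_apply,
    Matrix.of_apply, Matrix.cons_val_zero, Matrix.cons_val_one, Sum.elim_inl, Sum.elim_inr,
    Real.norm_eq_abs, sq_abs, Complex.sq_norm, Complex.normSq_apply]
  ring

/-- In the central unit cell the origin is a nearest lattice point: `|x i - k| ≥ 1 - |x i| ≥ |x i|`
for `k ≠ 0`. -/
theorem norm_le_infDist_integerLattice {ι : Type*} [Fintype ι] {x : EuclideanSpace ℝ ι}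
    (hx : ∀ i, |x i| ≤ 1 / 2) : ‖x‖ ≤ Metric.infDist x (integerLattice ι) := by
  refine (Metric.le_infDist ⟨0, fun i => ⟨0, by simp⟩⟩).2 fun y hy => ?_
  rw [dist_eq_norm, EuclideanSpace.norm_eq, EuclideanSpace.norm_eq]
  refine Real.sqrt_le_sqrt (Finset.sum_le_sum fun i _ => ?_)
  obtain ⟨k, hk⟩ := hy i
  rw [PiLp.sub_apply, hk, Real.norm_eq_abs, Real.norm_eq_abs]
  refine pow_le_pow_left₀ (abs_nonneg _) ?_ 2
  rcases eq_or_ne k 0 with rfl | hk0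
  · simp
  · have h1 : (1 : ℝ) ≤ |(k : ℝ)| := by exact_mod_cast Int.one_le_abs hk0
    have h2 := abs_sub_abs_le_abs_sub (k : ℝ) (x i)
    rw [abs_sub_comm] at h2
    linarith [hx i]

theorem min_le_infDist_of_norm_lt_complexLCD {n : ℕ} {α γ : ℝ} {v : EuclideanSpace ℂ (Fin n)}
    {u : EuclideanSpace ℝ (Fin 2)} (hu : ‖u‖ < complexLCD α γ v) :
    min (γ * ‖u‖) α ≤ Metric.infDist (WithLp.toLp 2 ((realMatrix v)ᵀ *ᵥ u.ofLp))
      (integerLattice (Fin n ⊕ Fin n)) := by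
  by_contra! h
  refine notMem_of_lt_csInf hu ⟨0, ?_⟩ ⟨u, rfl, h⟩
  rintro r ⟨θ, rfl, -⟩
  exact norm_nonneg _

/-- For shorter `θ` the image lies in the central cell, so its distance to the lattice is `‖θ‖ ≥
γ‖θ‖`. -/
theorem half_le_norm_of_infDist_lt {n : ℕ} {α γ : ℝ} (hγ : γ ≤ 1)
    {v : EuclideanSpace ℂ (Fin n)} (hv : ‖v‖ = 1) {θ : EuclideanSpace ℝ (Fin 2)}
    (hθ : Metric.infDist (WithLp.toLp 2 ((realMatrix v)ᵀ *ᵥ θ.ofLp))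
      (integerLattice (Fin n ⊕ Fin n)) < min (γ * ‖θ‖) α) : 1 / 2 ≤ ‖θ‖ := by
  by_contra! h
  have hnorm := norm_realMatrix_transpose_mulVec v θ
  rw [hv, one_mul] at hnorm
  have h1 := norm_le_infDist_integerLattice
    (x := WithLp.toLp 2 ((realMatrix v)ᵀ *ᵥ θ.ofLp)) fun i =>
      (PiLp.norm_apply_le _ i).trans (hnorm.le.trans h.le)
  have h2 := mul_le_mul_of_nonneg_right hγ (norm_nonneg θ)
  linarith [hθ.trans_le (min_le_left _ _)]

/-- Either no vector of the plane is sent close to the lattice, or the essential least common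
denominator is positive. -/
theorem forall_min_le_infDist_or_complexLCD_pos {n : ℕ} (α : ℝ) {γ : ℝ} (hγ : γ ≤ 1)
    {v : EuclideanSpace ℂ (Fin n)} (hv : ‖v‖ = 1) :
    (∀ u : EuclideanSpace ℝ (Fin 2), min (γ * ‖u‖) α ≤
      Metric.infDist (WithLp.toLp 2 ((realMatrix v)ᵀ *ᵥ u.ofLp)) (integerLattice (Fin n ⊕ Fin n)))
      ∨ 0 < complexLCD α γ v := by
  by_cases h : ∀ u : EuclideanSpace ℝ (Fin 2), min (γ * ‖u‖) α ≤
      Metric.infDist (WithLp.toLp 2 ((realMatrix v)ᵀ *ᵥ u.ofLp)) (integerLattice (Fin n ⊕ Fin n))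
  · exact Or.inl h
  · push Not at h
    obtain ⟨u, hu⟩ := h
    refine Or.inr (lt_of_lt_of_le one_half_pos (le_csInf ⟨_, u, rfl, hu⟩ ?_))
    rintro r ⟨θ, rfl, hθ⟩
    exact half_le_norm_of_infDist_lt hγ hv hθ

/-! ### Small ball estimate for `[v]ξ` -/

theorem aemeasurable_toLp_mulVec {Ω ι κ : Type*} [MeasurableSpace Ω] [Fintype ι] [Fintype κ]
    {P : Measure Ω} {ξ : ι → Ω → ℝ} (hm : ∀ i, AEMeasurable (ξ i) P) (A : Matrix κ ι ℝ) :
    AEMeasurable (fun ω => WithLp.toLp 2 (A *ᵥ fun i => ξ i ω)) P := by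
  refine (WithLp.measurable_toLp 2 (κ → ℝ)).comp_aemeasurable (aemeasurable_pi_lambda _ fun k => ?_)
  exact Finset.aemeasurable_fun_sum _ fun i _ => (hm i).const_mul (A k i)

/-- The characteristic function of a linear image of a random vector with independent entries. -/
theorem charFun_map_toLp_mulVec {Ω ι κ : Type*} [MeasurableSpace Ω] [Fintype ι] [Fintype κ]
    {P : Measure Ω} {ξ : ι → Ω → ℝ} (hind : iIndepFun ξ P)
    (hm : ∀ i, AEMeasurable (ξ i) P) (A : Matrix κ ι ℝ) (θ : EuclideanSpace ℝ κ) :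
    charFun (P.map fun ω => WithLp.toLp 2 (A *ᵥ fun i => ξ i ω)) θ
      = ∏ i, charFun (P.map (ξ i)) ((Aᵀ *ᵥ θ.ofLp) i) := by
  have hcf : ∀ i, charFun (P.map (ξ i)) ((Aᵀ *ᵥ θ.ofLp) i)
      = ∫ ω, Complex.exp (((Aᵀ *ᵥ θ.ofLp) i : ℂ) * (ξ i ω : ℂ) * Complex.I) ∂P := fun i => by
    rw [charFun_apply_real, integral_map (hm i) (Continuous.aestronglyMeasurable (by fun_prop))]
  simp_rw [hcf]
  rw [← hind.integral_fun_prod_comp hm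
      (f := fun i (x : ℝ) => Complex.exp (((Aᵀ *ᵥ θ.ofLp) i : ℂ) * (x : ℂ) * Complex.I))
      (fun i => Continuous.aestronglyMeasurable (by fun_prop)),
    charFun_apply, integral_map (aemeasurable_toLp_mulVec hm A)
      (Continuous.aestronglyMeasurable (by fun_prop))]
  refine integral_congr_ae (Filter.Eventually.of_forall fun ω => ?_)
  simp only
  rw [← Complex.exp_sum, ← Finset.sum_mul]
  congr 2
  rw [EuclideanSpace.inner_eq_star_dotProduct, star_trivial, Matrix.dotProduct_mulVec,
    ← Matrix.mulVec_transpose, dotProduct]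
  push_cast
  rfl

theorem exp_neg_mul_min_sq_le (c s t : ℝ) :
    Real.exp (-c * min s t ^ 2) ≤ Real.exp (-c * s ^ 2) + Real.exp (-c * t ^ 2) := by
  rcases min_choice s t with h | h <;> rw [h]
  · exact le_add_of_nonneg_right (Real.exp_pos _).le
  · exact le_add_of_nonneg_left (Real.exp_pos _).le

/-- Small ball probability bound, assuming that the dual vectors of norm at most `2 / ε` are
far from the integer lattice. -/
theorem measureReal_small_ball_le {Ω : Type*} [MeasurableSpace Ω] {P : Measure Ω}
    [IsProbabilityMeasure P] {n : ℕ} {ξ : Fin n ⊕ Fin n → Ω → ℝ} (hind : iIndepFun ξ P)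
    (hm : ∀ i, AEMeasurable (ξ i) P) {μ : Measure ℝ} [IsProbabilityMeasure μ]
    (hμ : ∀ i, P.map (ξ i) = μ) {K p : ℝ} (hK : 1 ≤ K) (hp : 0 < p)
    (hKp : p ≤ (μ.prod μ).real {q : ℝ × ℝ | |q.1 - q.2| ∈ Set.Icc 1 K})
    {v : EuclideanSpace ℂ (Fin n)} {α γ ε : ℝ} (hα : 0 < α) (hγ : 0 < γ) (hε : 0 < ε)
    (hdist : ∀ u : EuclideanSpace ℝ (Fin 2), ‖u‖ ≤ 2 / ε → min (γ * ‖u‖) α ≤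
      Metric.infDist (WithLp.toLp 2 ((realMatrix v)ᵀ *ᵥ u.ofLp)) (integerLattice (Fin n ⊕ Fin n)))
    (w : EuclideanSpace ℝ (Fin 2)) :
    P.real {ω | ‖WithLp.toLp 2 (realMatrix v *ᵥ fun i => ξ i ω) - w‖ ≤ ε}
      ≤ (K ^ 2 / (p * γ ^ 2 / Real.pi ^ 2) * ε ^ 2 + Real.exp (-(4 * p) * α ^ 2))
        / Real.cos 1 ^ 2 := by
  set S : Ω → EuclideanSpace ℝ (Fin 2) :=
    fun ω => WithLp.toLp 2 (realMatrix v *ᵥ fun i => ξ i ω) with hS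
  have hSm : AEMeasurable S P := aemeasurable_toLp_mulVec hm _
  have : IsProbabilityMeasure (P.map S) := Measure.isProbabilityMeasure_map hSm
  have hpi := Real.pi_pos
  have hK0 : 0 < K := by linarith
  have hs : MeasurableSet {q : ℝ × ℝ | |q.1 - q.2| ∈ Set.Icc 1 K} :=
    measurableSet_Icc.preimage (by fun_prop : Measurable fun q : ℝ × ℝ => |q.1 - q.2|)
  set a := p * γ ^ 2 / Real.pi ^ 2 with ha
  have ha0 : 0 < a := by positivity
  have hφ : ∀ u : EuclideanSpace ℝ (Fin 2), ‖u‖ ≤ 2 * (1 / (K * ε)) →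
      ‖charFun (P.map S) u‖ ≤ Real.exp (-a * ‖u‖ ^ 2) + Real.exp (-(4 * p) * α ^ 2) := by
    intro u hu
    rw [hS, charFun_map_toLp_mulVec hind hm, norm_prod]
    simp_rw [hμ]
    have hd0 : 0 ≤ min (γ * (‖u‖ / (2 * Real.pi))) α := le_min (by positivity) hα.le
    refine (prod_norm_charFun_le_exp μ (WithLp.toLp 2 ((realMatrix v)ᵀ *ᵥ u.ofLp)) hs hd0
      fun q hq => ?_).trans ?_
    · set z := (q.1 - q.2) / (2 * Real.pi) with hz
      have hzabs : |z| = |q.1 - q.2| / (2 * Real.pi) := by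
        rw [hz, abs_div, abs_of_pos Real.two_pi_pos]
      have hzu : ‖z • u‖ = |q.1 - q.2| * ‖u‖ / (2 * Real.pi) := by
        rw [norm_smul, Real.norm_eq_abs, hzabs]; ring
      have hle : ‖z • u‖ ≤ 2 / ε := by
        rw [hzu]
        calc |q.1 - q.2| * ‖u‖ / (2 * Real.pi) ≤ K * (2 * (1 / (K * ε))) / (2 * Real.pi) := by
              gcongr; exact hq.2
          _ = 1 / ε / Real.pi := by field_simp
          _ ≤ 1 / ε := div_le_self (by positivity) (by linarith [Real.pi_gt_three])
          _ ≤ 2 / ε := by gcongr; norm_num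
      have h1 := hdist (z • u) hle
      rw [show WithLp.toLp 2 ((realMatrix v)ᵀ *ᵥ (z • u).ofLp)
        = z • WithLp.toLp 2 ((realMatrix v)ᵀ *ᵥ u.ofLp) by
          rw [WithLp.ofLp_smul, Matrix.mulVec_smul, WithLp.toLp_smul]] at h1
      -- The upper bound `K` kept `z • u` within range of `hdist`; the lower bound `1` now keeps it
      -- from being too short.
      refine le_trans (min_le_min_right _ ?_) h1
      rw [hzu]
      gcongr
      exact le_mul_of_one_le_left (norm_nonneg u) hq.1
    · refine le_trans (Real.exp_le_exp.2 ?_)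
        ((exp_neg_mul_min_sq_le (4 * p) (γ * (‖u‖ / (2 * Real.pi))) α).trans (le_of_eq ?_))
      · have := mul_le_mul_of_nonneg_right hKp (sq_nonneg (min (γ * (‖u‖ / (2 * Real.pi))) α))
        linarith
      · congr 2
        rw [ha]
        field_simp
        ring
  -- The radius `1/(Kε)` compensates for the stretching of `u` by up to `K`.
  have hE := measureReal_closedBall_le_of_norm_charFun_le (P.map S) (ρ := 1 / (K * ε)) (ε := ε)
    (by positivity) ha0 (by
      rw [show 1 / (K * ε) * ε = 1 / K by field_simp]
      exact (div_le_one hK0).2 hK) hφ w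
  have hV : volume.real (Metric.closedBall (0 : EuclideanSpace ℝ (Fin 2)) (1 / (K * ε)))
      = (1 / (K * ε)) ^ 2 * Real.pi := by
    rw [measureReal_def, EuclideanSpace.volume_closedBall_fin_two, ENNReal.toReal_mul,
      ENNReal.toReal_pow, ENNReal.toReal_ofReal (by positivity), ENNReal.toReal_ofReal hpi.le]
  have hPB : (P.map S).real (Metric.closedBall w ε) = P.real {ω | ‖S ω - w‖ ≤ ε} := by
    rw [map_measureReal_apply_of_aemeasurable hSm Metric.isClosed_closedBall.measurableSet]
    simp only [Set.preimage, mem_closedBall_iff_norm]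
  rw [hPB, hV, finrank_euclideanSpace_fin, Nat.cast_ofNat, div_self two_ne_zero,
    Real.rpow_one] at hE
  have hcos : 0 < Real.cos 1 := Real.cos_one_pos
  rw [le_div_iff₀ (by positivity)]
  have hV0 : 0 < ((1 / (K * ε)) ^ 2 * Real.pi) ^ 2 := by positivity
  refine le_of_mul_le_mul_right (le_trans (le_of_eq ?_) (hE.trans (le_of_eq ?_))) hV0
  · ring
  · field_simp

theorem theorem5p5 (B : ℝ) (hB : 0 < B) :
    ∃ c : ℝ, 0 < c ∧ ∀ γ : ℝ, 0 < γ → γ < 1 → ∃ C : ℝ, 0 < C ∧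
      ∀ (Ω : Type*) [MeasurableSpace Ω] (P : Measure Ω) [IsProbabilityMeasure P]
        (n : ℕ) (ξ : Fin n ⊕ Fin n → Ω → ℝ),
        iIndepFun ξ P →
        (∀ i j, IdentDistrib (ξ i) (ξ j) P P) →
        (∀ i, ∫ ω, ξ i ω ∂P = 0) →
        (∀ i, variance (ξ i) P = 1) →
        (∀ i, IsSubgaussianWith P (ξ i) B) →
        ∀ v : EuclideanSpace ℂ (Fin n), ‖v‖ = 1 →
        ∀ α : ℝ, 0 < α →
        ∀ ε : ℝ, 4 / complexLCD α γ v ≤ ε →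
          (⨆ w : EuclideanSpace ℝ (Fin 2),
              P {ω | ‖WithLp.toLp 2 (realMatrix v *ᵥ fun i => ξ i ω) - w‖ ≤ ε})
            ≤ ENNReal.ofReal (C * ε ^ 2 + C * Real.exp (-c * α ^ 2)) := by
  obtain ⟨K, p, hK, hp, hKp⟩ := exists_le_measureReal_abs_sub_mem_Icc hB
  have hcos : 0 < Real.cos 1 := Real.cos_one_pos
  refine ⟨4 * p, by positivity, fun γ hγ hγ1 => ?_⟩
  have hD : 0 ≤ K ^ 2 / (p * γ ^ 2 / Real.pi ^ 2) := by positivity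
  set D := K ^ 2 / (p * γ ^ 2 / Real.pi ^ 2)
  -- One constant serves both terms: `D` is needed for `ε²` and `1` for the exponential.
  refine ⟨(D + 1) / Real.cos 1 ^ 2, by positivity, ?_⟩
  intro Ω _ P _ n ξ hind hid hmean hvar hsub v hv α hα ε hε
  have hm : ∀ i, AEMeasurable (ξ i) P := fun i => (hid i i).aemeasurable_fst
  obtain ⟨j⟩ : Nonempty (Fin n) := by
    by_contra h
    rw [not_nonempty_iff] at h
    simp [Subsingleton.elim v 0] at hv
  set μ := P.map (ξ (Sum.inl j)) with hμ
  have : IsProbabilityMeasure μ := Measure.isProbabilityMeasure_map (hm _)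
  have hp' := hKp μ (fun t ht => by
      rw [hμ, map_measureReal_apply_of_aemeasurable (hm _)
        (measurableSet_lt measurable_const (by fun_prop))]
      exact (hsub (Sum.inl j)).2 t ht)
    (by rw [hμ, integral_map (hm _) (by fun_prop)]; exact hmean _)
    (by rw [hμ, variance_id_map (hm _)]; exact hvar _)
  have hsmall : ∀ w : EuclideanSpace ℝ (Fin 2), ∀ δ : ℝ, 0 < δ →
      (∀ u : EuclideanSpace ℝ (Fin 2), ‖u‖ ≤ 2 / δ → min (γ * ‖u‖) α ≤
        Metric.infDist (WithLp.toLp 2 ((realMatrix v)ᵀ *ᵥ u.ofLp))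
          (integerLattice (Fin n ⊕ Fin n))) →
      P.real {ω | ‖WithLp.toLp 2 (realMatrix v *ᵥ fun i => ξ i ω) - w‖ ≤ δ}
        ≤ (D + 1) / Real.cos 1 ^ 2 * δ ^ 2
          + (D + 1) / Real.cos 1 ^ 2 * Real.exp (-(4 * p) * α ^ 2) := by
    intro w δ hδ hdist
    refine (measureReal_small_ball_le hind hm (fun i => (hid i (Sum.inl j)).map_eq) hK hp hp'
      hα hγ hδ hdist w).trans ?_
    rw [div_mul_eq_mul_div (D + 1) _ (δ ^ 2), div_mul_eq_mul_div (D + 1), ← add_div]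
    change (D * δ ^ 2 + _) / _ ≤ _
    gcongr
    · linarith
    · exact le_mul_of_one_le_left (Real.exp_pos _).le (by linarith)
  refine iSup_le fun w => ?_
  rw [← ofReal_measureReal]
  refine ENNReal.ofReal_le_ofReal ?_
  rcases forall_min_le_infDist_or_complexLCD_pos α hγ1.le hv with hall | hpos
  -- Here the set defining the LCD is empty, so `sInf` and `4 / 0` take the value `0` and `ε = 0` is
  -- allowed. The estimate holds at every `δ > ε`, and `δ` decreases to `ε`.
  · have hε0 : 0 ≤ ε := le_trans (div_nonneg (by norm_num) (Real.sInf_nonneg (by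
      rintro r ⟨θ, rfl, -⟩; exact norm_nonneg _))) hε
    refine ge_of_tendsto (x := nhdsWithin ε (Set.Ioi ε))
      (f := fun δ => (D + 1) / Real.cos 1 ^ 2 * δ ^ 2
        + (D + 1) / Real.cos 1 ^ 2 * Real.exp (-(4 * p) * α ^ 2))
      (Continuous.tendsto (by fun_prop) ε |>.mono_left nhdsWithin_le_nhds) ?_
    filter_upwards [self_mem_nhdsWithin] with δ hδ
    have hδ : ε < δ := hδ
    exact (measureReal_mono fun ω hω => le_trans hω hδ.le).trans
      (hsmall w δ (hε0.trans_lt hδ) fun u _ => hall u)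
  · have hε0 : 0 < ε := (div_pos (by norm_num) hpos).trans_le hε
    -- The hypothesis gives `2/ε < 4/ε ≤ LCD`; this strictness is what allows the closed range `‖u‖
    -- ≤ 2/ε`.
    refine hsmall w ε hε0 fun u hu => min_le_infDist_of_norm_lt_complexLCD ?_
    rw [div_le_iff₀ hpos] at hε
    refine hu.trans_lt ?_
    rw [div_lt_iff₀ hε0]
    linarith
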